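/- Let $0\le k\le d$ and $n\ge 0$ be integers, and let $\gamma\in\wedge^{k+1}\mathbb C^{d+1}\otimes M_n(\mathbb C)$. For $\mu\in\mathbb C^{d+1}$ regard $\gamma\wedge\mu$ as a linear map $\mathbb C^n\to\wedge^{k+2}\mathbb C^{d+1}\otimes\mathbb C^n$, and put $$D(\gamma)=\{\mu\in\mathbb P^d \mid (\gamma\wedge\mu)v=0 \text{ for some } v\in\mathbb C^n\setminus\{0\}\},$$ a Zariski closed subset of $\mathbb P^d$. Assume that $\gamma$ is non-degenerate: there are linearly independent $v_0,\dots,v_{d-k-1}\in\mathbb C^{d+1}$ such that $\gamma\wedge v_0\wedge\dots\wedge v_{d-k-1}=(e_0\wedge\dots\wedge e_d)\otimes A$ with $A\in M_n(\mathbb C)$ invertible, where $e_0,\dots,e_d$ is the standard basis of $\mathbb C^{d+1}$. For an irreducible component $D_j$ of $D(\gamma)$ let $n_j$ be the dimension of the generic fiber of the kernel sheaf $\mathcal K=\ker\bigl(\gamma\wedge\mu:\mathcal O_{D_j}(-1)^n\to\wedge^{k+2}\mathbb C^{d+1}\otimes\mathcal O_{D_j}^n\bigr)$, and define $$\deg(\gamma)=\sum_{\dim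 D_j=k} n_j\,\deg D_j ,$$ the sum over the $k$-dimensional irreducible components of $D(\gamma)$, where $\deg D_j$ is the degree of $D_j$ as a projective variety in $\mathbb P^d$ ($k!$ times the coefficient of $m^k$ in its Hilbert polynomial). Then: 1. $\deg(\gamma)\le n$. 2. If $\deg(\gamma)=n$ (that is, if $\gamma$ is very reasonable), then $D(\gamma)$ has pure dimension $k$: every irreducible component of $D(\gamma)$ has dimension $k$. -/

import Mathlib

open Filter Topology
open scoped TensorProduct

noncomputable section

namespace Livsic

/-! ### Projective space with its Zariski topology -/

/-- The set of points of complex projective space of dimension `d`. A type synonym, so that it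
carries the Zariski topology below and no other. -/
def PP (d : ℕ) : Type := Projectivization ℂ (Fin (d + 1) → ℂ)

/-- The common zeros in projective space of a set of homogeneous polynomials. (Whether a
homogeneous polynomial vanishes at a point does not depend on the representative.) -/
def projZeros {d : ℕ} (T : Set (MvPolynomial (Fin (d + 1)) ℂ)) : Set (PP d) :=
  {p | ∀ f ∈ T, MvPolynomial.eval (Projectivization.rep p) f = 0}

/-- Projective algebraic sets: common zeros of sets of homogeneous polynomials. -/
def IsProjAlgebraic {d : ℕ} (X : Set (PP d)) : Prop :=
  ∃ T : Set (MvPolynomial (Fin (d + 1)) ℂ), (∀ f ∈ T, ∃ m, f.IsHomogeneous m) ∧ X = projZeros T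

/-- The Zariski topology: the closed sets are the projective algebraic sets. -/
instance zariski (d : ℕ) : TopologicalSpace (PP d) :=
  TopologicalSpace.ofClosed {X | IsProjAlgebraic X}
    (by
      refine ⟨{1}, ?_, ?_⟩
      · rintro f rfl
        exact ⟨0, MvPolynomial.isHomogeneous_one _ _⟩
      · ext p
        simp [projZeros])
    (by
      intro A hA
      refine ⟨{f | ∃ T : Set (MvPolynomial (Fin (d + 1)) ℂ),
        (∀ g ∈ T, ∃ m, g.IsHomogeneous m) ∧ projZeros T ∈ A ∧ f ∈ T}, ?_, ?_⟩
      · rintro f ⟨T, hT, -, hf⟩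
        exact hT f hf
      · ext p
        constructor
        · rintro hp f ⟨T, -, hTA, hf⟩
          exact hp _ hTA f hf
        · intro hp X hX
          obtain ⟨T, hT, rfl⟩ := hA hX
          exact fun f hf => hp f ⟨T, hT, hX, hf⟩)
    (by
      rintro _ ⟨T, hT, rfl⟩ _ ⟨T', hT', rfl⟩
      refine ⟨{h | ∃ f ∈ T, ∃ g ∈ T', h = f * g}, ?_, ?_⟩
      · rintro _ ⟨f, hf, g, hg, rfl⟩
        obtain ⟨a, ha⟩ := hT f hf
        obtain ⟨b, hb⟩ := hT' g hg
        exact ⟨a + b, ha.mul hb⟩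
      · ext p
        constructor
        · rintro (hp | hp) _ ⟨f, hf, g, hg, rfl⟩
          · simp [hp f hf]
          · simp [hp g hg]
        · intro hp
          by_contra hcon
          simp only [Set.mem_union, not_or] at hcon
          obtain ⟨h1, h2⟩ := hcon
          simp only [projZeros, Set.mem_ofPred_eq, not_forall] at h1 h2
          obtain ⟨f, hf, hf0⟩ := h1
          obtain ⟨g, hg, hg0⟩ := h2
          have h3 := hp (f * g) ⟨f, hf, g, hg, rfl⟩
          rw [map_mul] at h3
          exact (mul_ne_zero hf0 hg0) h3)

theorem isClosed_iff {d : ℕ} (X : Set (PP d)) : IsClosed X ↔ IsProjAlgebraic X := by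
  rw [← isOpen_compl_iff]
  change Xᶜᶜ ∈ {X | IsProjAlgebraic X} ↔ _
  rw [compl_compl]
  rfl

/-- The irreducible components of a subset of projective space (with the induced topology),
as subsets of projective space. -/
def components {d : ℕ} (X : Set (PP d)) : Set (Set (PP d)) :=
  (fun s : Set X => Subtype.val '' s) '' irreducibleComponents X

/-- The dimension of a subset of projective space: its Krull dimension for the Zariski topology
(the empty set has dimension `⊥`). -/
def dim {d : ℕ} (X : Set (PP d)) : WithBot ℕ∞ := topologicalKrullDim X

/-- `X` has pure dimension `k`: all its irreducible components have dimension `k`. -/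
def HasPureDim {d : ℕ} (X : Set (PP d)) (k : ℕ) : Prop :=
  ∀ Z ∈ components X, dim Z = k

/-- The homogeneous ideal of a subset of projective space: the ideal of the affine cone
over it. -/
def homIdeal {d : ℕ} (X : Set (PP d)) : Ideal (MvPolynomial (Fin (d + 1)) ℂ) :=
  MvPolynomial.vanishingIdeal ℂ {x : Fin (d + 1) → ℂ | ∃ p ∈ X, x ∈ Projectivization.submodule p}

/-- The homogeneous coordinate ring. -/
abbrev CoordRing {d : ℕ} (X : Set (PP d)) : Type :=
  MvPolynomial (Fin (d + 1)) ℂ ⧸ homIdeal X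

/-- The Hilbert function of `X`: the dimension of the degree `m` part of the homogeneous
coordinate ring. -/
def hilbertFun {d : ℕ} (X : Set (PP d)) (m : ℕ) : ℕ :=
  Module.finrank ℂ ((MvPolynomial.homogeneousSubmodule (Fin (d + 1)) ℂ m).map
    (Ideal.Quotient.mkₐ ℂ (homIdeal X)).toLinearMap)

/-- The degree of a projective variety `X` of dimension `k`: `k!` times the coefficient of `m ^ k`
in the Hilbert polynomial of `X`, that is, the limit of `k! * h_X(m) / m ^ k`. -/
def varDegree {d : ℕ} (k : ℕ) (X : Set (PP d)) : ℝ :=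
  limUnder atTop (fun m : ℕ => (k.factorial : ℝ) * hilbertFun X m / (m : ℝ) ^ k)

/-! ### Tensors -/

/-- The space `∧^{k+1} ℂ^{d+1} ⊗ M_n(ℂ)`. -/
abbrev Tensor (d k n : ℕ) : Type :=
  (⋀[ℂ]^(k + 1) (Fin (d + 1) → ℂ)) ⊗[ℂ] Matrix (Fin n) (Fin n) ℂ

/-- The exterior algebra of `ℂ^{d+1}`. -/
abbrev Ext (d : ℕ) : Type := ExteriorAlgebra ℂ (Fin (d + 1) → ℂ)

/-- `γ ∧ ω`, for `ω` in the exterior algebra: `(η ⊗ A) ∧ ω = (η ∧ ω) ⊗ A`. -/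
def wedge {d k n : ℕ} (γ : Tensor d k n) (ω : Ext d) : Ext d ⊗[ℂ] Matrix (Fin n) (Fin n) ℂ :=
  LinearMap.rTensor (Matrix (Fin n) (Fin n) ℂ)
    ((LinearMap.mulRight ℂ ω).comp (⋀[ℂ]^(k + 1) (Fin (d + 1) → ℂ)).subtype) γ

@[simp]
theorem wedge_tmul {d k n : ℕ} (η : ⋀[ℂ]^(k + 1) (Fin (d + 1) → ℂ))
    (A : Matrix (Fin n) (Fin n) ℂ) (ω : Ext d) :
    wedge (η ⊗ₜ[ℂ] A) ω = ((η : Ext d) * ω) ⊗ₜ[ℂ] A := rfl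

/-- An element of `∧ℂ^{d+1} ⊗ M_n(ℂ)` as a linear map `ℂ^n → ∧ℂ^{d+1} ⊗ ℂ^n`. -/
def toMap {d n : ℕ} (T : Ext d ⊗[ℂ] Matrix (Fin n) (Fin n) ℂ) :
    (Fin n → ℂ) →ₗ[ℂ] Ext d ⊗[ℂ] (Fin n → ℂ) :=
  ((LinearMap.lTensorHom (Ext d)).comp (Matrix.mulVecBilin ℂ ℂ).flip).flip T

@[simp]
theorem toMap_tmul {d n : ℕ} (η : Ext d) (A : Matrix (Fin n) (Fin n) ℂ) (v : Fin n → ℂ) :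
    toMap (η ⊗ₜ[ℂ] A) v = η ⊗ₜ[ℂ] (A.mulVec v) := rfl

/-- `γ` is non-degenerate: there are linearly independent vectors `v_0, …, v_{d-k-1}` such that
`γ ∧ v_0 ∧ ⋯ ∧ v_{d-k-1} = (e_0 ∧ ⋯ ∧ e_d) ⊗ A` with an invertible matrix `A`.
(Meant for `k ≤ d`.) -/
def IsNondegenerate {d k n : ℕ} (γ : Tensor d k n) : Prop :=
  ∃ v : Fin (d - k) → (Fin (d + 1) → ℂ), LinearIndependent ℂ v ∧
    ∃ A : Matrix (Fin n) (Fin n) ℂ, IsUnit A ∧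
      wedge γ (ExteriorAlgebra.ιMulti ℂ (d - k) v) =
        ExteriorAlgebra.ιMulti ℂ (d + 1) (fun i => (Pi.single i 1 : Fin (d + 1) → ℂ)) ⊗ₜ[ℂ] A

/-- `D(γ)`: the points `μ` with `(γ ∧ μ) v = 0` for some nonzero `v`. (The condition does not
depend on the representative of the point.) -/
def locus {d k n : ℕ} (γ : Tensor d k n) : Set (PP d) :=
  {p | ∃ v : Fin n → ℂ, v ≠ 0 ∧
    toMap (wedge γ (ExteriorAlgebra.ι ℂ (Projectivization.rep p))) v = 0}

/-- The map `γ ∧ x` over the homogeneous coordinate ring `B` of `X`, where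
`x = ∑ x_j e_j` is the tautological vector of coordinate functions: a `B`-linear map
`B ⊗ ℂ^n → B ⊗ (∧ℂ^{d+1} ⊗ ℂ^n)`. -/
def coordWedge {d k n : ℕ} (γ : Tensor d k n) (X : Set (PP d)) :
    CoordRing X ⊗[ℂ] (Fin n → ℂ) →ₗ[CoordRing X] CoordRing X ⊗[ℂ] (Ext d ⊗[ℂ] (Fin n → ℂ)) :=
  ∑ j : Fin (d + 1), (Ideal.Quotient.mk (homIdeal X) (MvPolynomial.X j) : CoordRing X) •
    (toMap (wedge γ (ExteriorAlgebra.ι ℂ (Pi.single j 1)))).baseChange (CoordRing X)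

/-- The multiplicity of an irreducible component `X` of `D(γ)`: the dimension of the generic fiber
of the kernel sheaf of `γ ∧ μ` on `X`. The kernel sheaf is the sheaf of the graded module
`ker (γ ∧ x)` over the homogeneous coordinate ring of `X`; the fraction field of that ring extends
the function field of `X`, and the dimension may be computed over it. -/
def genericKernelDim {d k n : ℕ} (γ : Tensor d k n) (X : Set (PP d)) : ℕ :=
  Module.finrank (FractionRing (CoordRing X))
    (FractionRing (CoordRing X) ⊗[CoordRing X] LinearMap.ker (coordWedge γ X))

/-- The degree of `γ`, that is, of the `k`-dimensional part of the cycle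
`Z(γ) = ∑ n_j [D_j]`: the sum of `n_j * deg D_j` over the irreducible components `D_j` of
dimension `k` of `D(γ)`. -/
def degree {d k n : ℕ} (γ : Tensor d k n) : ℝ :=
  ∑ᶠ Z ∈ {Z ∈ components (locus γ) | dim Z = k}, (genericKernelDim γ Z : ℝ) * varDegree k Z

/-- `γ` is very reasonable. -/
def IsVeryReasonable {d k n : ℕ} (γ : Tensor d k n) : Prop :=
  degree γ = n

end Livsic

end

/-!
Let `P = ℂ[x_0, …, x_d]`, and let `M` be the cokernel of the transpose of `γ ∧ x`, a graded quotient
of `P^n` whose support is the affine cone over `D(γ)`. Non-degeneracy solves for `d - k` of the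
coordinates: the `n` generators of `M` over `P` already generate it over the polynomial ring `S` in
the other `k + 1` linear forms. So the coordinate ring `P/I_Z` of a `k`-dimensional component `Z` is
finite and torsion-free over `S`, its rank is `deg Z`, and `n_Z` is at most the dimension of
`Hom_P(M, Frac(P/I_Z))` over `Frac(P/I_Z)`. Composing with a nonzero `Frac S`-linear functional on
`Frac(P/I_Z)` for each `Z` embeds the sum of these spaces into `Hom_S(M, Frac S)`, whence
`deg γ ≤ rank_S M ≤ n`.

If `deg γ = n`, this embedding is onto `(Frac S)^n`, so every `S`-relation among the `n` generators
is trivial and a polynomial vanishing on all `k`-dimensional components annihilates `M`. Hence it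
vanishes on `D(γ)`, which leaves no room for further components.
-/

noncomputable section

open scoped nonZeroDivisors

namespace Livsic

section LinearForm

open MvPolynomial

variable {K σ : Type*} [Field K] [Fintype σ]

/-- The linear form `∑ j, α (e_j) X_j`: a functional on `K^σ` as a polynomial function. -/
def linForm [DecidableEq σ] : Module.Dual K (σ → K) →ₗ[K] MvPolynomial σ K :=
  ∑ j, (LinearMap.toSpanSingleton K _ (X j)).comp (Module.Dual.eval K (σ → K) (Pi.single j 1))

variable [DecidableEq σ]

theorem linForm_apply (α : Module.Dual K (σ → K)) :
    linForm α = ∑ j, α (Pi.single j 1) • X j := by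
  simp [linForm]

@[simp]
theorem linForm_proj (j : σ) : linForm (LinearMap.proj j : Module.Dual K (σ → K)) = X j := by
  simp [linForm_apply, Pi.single_apply, Finset.sum_ite_eq]

theorem isHomogeneous_linForm (α : Module.Dual K (σ → K)) : (linForm α).IsHomogeneous 1 := by
  rw [linForm_apply]
  exact IsHomogeneous.sum _ _ _ fun j _ => by
    rw [smul_eq_C_mul]
    exact isHomogeneous_C_mul_X _ j

@[simp]
theorem eval_linForm (x : σ → K) (α : Module.Dual K (σ → K)) : eval x (linForm α) = α x := by
  conv_rhs => rw [pi_eq_sum_univ' x]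
  simp [linForm_apply, mul_comm]

end LinearForm

section LinearFamily

open MvPolynomial

variable {K σ W ν : Type*} [Field K] [AddCommGroup W] [Module K W]

/-- The functional `μ ↦ θ (B μ u)` attached to a linear family `μ ↦ B μ` of linear maps. -/
def pairing (B : (σ → K) →ₗ[K] (ν → K) →ₗ[K] W) (θ : Module.Dual K W) (u : ν → K) :
    Module.Dual K (σ → K) :=
  θ.comp (B.flip u)

@[simp]
theorem pairing_apply (B : (σ → K) →ₗ[K] (ν → K) →ₗ[K] W) (θ : Module.Dual K W) (u : ν → K)
    (x : σ → K) : pairing B θ u x = θ (B x u) := rfl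

variable [Fintype σ] [DecidableEq σ] [DecidableEq ν]
  (B : (σ → K) →ₗ[K] (ν → K) →ₗ[K] W)

/-- The rows of the matrix of linear forms that represents the linear family `μ ↦ B μ`. -/
def relation (θ : Module.Dual K W) : ν → MvPolynomial σ K :=
  fun p => linForm (pairing B θ (Pi.single p 1))

/-- The cokernel of the transpose of the matrix of linear forms which represents the linear family
`μ ↦ B μ`: a module over the polynomial ring, supported at those `μ` for which `B μ` is not
injective. -/
abbrev TransposeCokernel : Type _ :=
  (ν → MvPolynomial σ K) ⧸ Submodule.span (MvPolynomial σ K) (Set.range (relation B))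

/-- The generators of the cokernel given by the standard basis. -/
def TransposeCokernel.gen (p : ν) : TransposeCokernel B :=
  Submodule.Quotient.mk (Pi.single p 1)

namespace TransposeCokernel

theorem mk_eq_sum [Fintype ν] (f : ν → MvPolynomial σ K) :
    (Submodule.Quotient.mk f : TransposeCokernel B) = ∑ p, f p • gen B p := by
  conv_lhs => rw [pi_eq_sum_univ' f]
  simp only [gen, ← Submodule.mkQ_apply, map_sum, map_smul]

theorem sum_linForm_pairing_smul_gen [Fintype ν] (θ : Module.Dual K W) :
    ∑ p, linForm (pairing B θ (Pi.single p 1)) • gen B p = 0 :=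
  (mk_eq_sum B (relation B θ)).symm.trans <|
    (Submodule.Quotient.mk_eq_zero _).mpr (Submodule.subset_span ⟨θ, rfl⟩)

theorem span_gen [Finite ν] : Submodule.span (MvPolynomial σ K) (Set.range (gen B)) = ⊤ := by
  have := Fintype.ofFinite ν
  refine eq_top_iff.mpr fun x _ => ?_
  obtain ⟨f, rfl⟩ := Submodule.Quotient.mk_surjective _ x
  rw [mk_eq_sum]
  exact Submodule.sum_mem _ fun p _ =>
    Submodule.smul_mem _ _ (Submodule.subset_span (Set.mem_range_self p))

theorem eval_smul_eq_zero_of_mem_annihilator [Finite ν] {f : MvPolynomial σ K}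
    (hf : f ∈ Module.annihilator (MvPolynomial σ K) (TransposeCokernel B)) {x : σ → K}
    {u : ν → K} (hu : B x u = 0) : eval x f • u = 0 := by
  have := Fintype.ofFinite ν
  have hdot : ∀ g ∈ Submodule.span (MvPolynomial σ K) (Set.range (relation B)),
      ∑ p, eval x (g p) * u p = 0 := by
    intro g hg
    induction hg using Submodule.span_induction with
    | mem g hg =>
      obtain ⟨θ, rfl⟩ := hg
      have := congrArg θ hu
      rw [pi_eq_sum_univ' u] at this
      simpa [relation, mul_comm] using this
    | zero => simp
    | add g h _ _ hg hh => simp [add_mul, Finset.sum_add_distrib, hg, hh]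
    | smul a g _ hg => simp [mul_assoc, ← Finset.mul_sum, hg]
  ext q
  have hq := Module.mem_annihilator.mp hf (gen B q)
  rw [gen, ← Submodule.Quotient.mk_smul, Submodule.Quotient.mk_eq_zero] at hq
  simpa [Pi.single_apply, apply_ite] using hdot _ hq

section Spanning

variable {S ι κ : Type*} [CommRing S] [Algebra K S] [Algebra S (MvPolynomial σ K)]
  [IsScalarTower K S (MvPolynomial σ K)] [Finite ν] [Finite ι] [DecidableEq ι] [Finite κ]

theorem linForm_smul_gen_mem_span (b : Module.Basis (ι ⊕ κ) K (σ → K)) (Θ : ι → W →ₗ[K] ν → K)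
    (hΘ : ∀ i i' u, Θ i (B (b (.inl i')) u) = if i = i' then u else 0)
    (hS : ∀ l, linForm (b.coord (.inr l)) ∈ (algebraMap S (MvPolynomial σ K)).range)
    (α : Module.Dual K (σ → K)) (q : ν) :
    linForm α • gen B q ∈ Submodule.span S (Set.range (gen B)) := by
  have := Fintype.ofFinite ν
  have := Fintype.ofFinite ι
  have := Fintype.ofFinite κ
  set N := Submodule.span S (Set.range (gen B))
  have hK (c : K) {x} (hx : x ∈ N) : c • x ∈ N := by
    rw [← algebraMap_smul S c x]
    exact N.smul_mem _ hx
  have hinr (l : κ) (p : ν) : linForm (b.coord (.inr l)) • gen B p ∈ N := by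
    obtain ⟨s, hs⟩ := hS l
    rw [← hs, algebraMap_smul]
    exact N.smul_mem s (Submodule.subset_span (Set.mem_range_self p))
  have hexpand (β : Module.Dual K (σ → K)) : β = ∑ i, β (b i) • b.coord i :=
    (b.sum_dual_apply_smul_coord β).symm
  have hinl (i : ι) : linForm (b.coord (.inl i)) • gen B q ∈ N := by
    have hrel := sum_linForm_pairing_smul_gen B ((LinearMap.proj q).comp (Θ i))
    have hpair (p : ν) : linForm (pairing B ((LinearMap.proj q).comp (Θ i)) (Pi.single p 1)) =
        (if q = p then linForm (b.coord (.inl i)) else 0) + ∑ l,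
          pairing B ((LinearMap.proj q).comp (Θ i)) (Pi.single p 1) (b (.inr l)) •
            linForm (b.coord (.inr l)) := by
      conv_lhs => rw [hexpand (pairing B _ _), Fintype.sum_sum_type, map_add, map_sum, map_sum]
      congr 1
      · rw [Finset.sum_eq_single_of_mem i (Finset.mem_univ i) fun i' _ hi => by
          simp [hΘ, hi.symm]]
        simp [hΘ, Pi.single_apply, apply_ite linForm]
      · simp
    simp only [hpair, add_smul, ite_smul, zero_smul, Finset.sum_add_distrib, Finset.sum_ite_eq,
      Finset.mem_univ, if_true, Finset.sum_smul, smul_assoc] at hrel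
    rw [eq_neg_of_add_eq_zero_left hrel]
    exact N.neg_mem (N.sum_mem fun p _ => N.sum_mem fun l _ => hK _ (hinr l p))
  rw [hexpand α, map_sum, Finset.sum_smul]
  refine N.sum_mem fun i _ => ?_
  rw [map_smul, smul_assoc]
  cases i with
  | inl i => exact hK _ (hinl i)
  | inr l => exact hK _ (hinr l q)

theorem span_gen_eq_top (b : Module.Basis (ι ⊕ κ) K (σ → K)) (Θ : ι → W →ₗ[K] ν → K)
    (hΘ : ∀ i i' u, Θ i (B (b (.inl i')) u) = if i = i' then u else 0)
    (hS : ∀ l, linForm (b.coord (.inr l)) ∈ (algebraMap S (MvPolynomial σ K)).range) :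
    Submodule.span S (Set.range (gen B)) = ⊤ := by
  set N := Submodule.span S (Set.range (gen B))
  have hX (j : σ) {x} (hx : x ∈ N) : (X j : MvPolynomial σ K) • x ∈ N := by
    induction hx using Submodule.span_induction with
    | mem x hx =>
      obtain ⟨q, rfl⟩ := hx
      simpa using linForm_smul_gen_mem_span B b Θ hΘ hS (LinearMap.proj j) q
    | zero => simp
    | add x y _ _ hx hy => simpa using N.add_mem hx hy
    | smul s x _ hx => simpa [smul_comm _ s] using N.smul_mem s hx
  have hP (f : MvPolynomial σ K) {x} (hx : x ∈ N) : f • x ∈ N := by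
    induction f using MvPolynomial.induction_on generalizing x with
    | C a =>
      rw [← algebraMap_eq, algebraMap_smul, ← algebraMap_smul S]
      exact N.smul_mem _ hx
    | add f g hf hg => simpa [add_smul] using N.add_mem (hf hx) (hg hx)
    | mul_X f j hf => simpa [mul_smul] using hf (hX j hx)
  refine eq_top_iff.mpr fun x _ => ?_
  induction (span_gen B ▸ Submodule.mem_top : x ∈ Submodule.span (MvPolynomial σ K) _)
    using Submodule.span_induction with
  | mem x hx => exact Submodule.subset_span hx
  | zero => exact N.zero_mem
  | add x y _ _ hx hy => exact N.add_mem (hx trivial) (hy trivial)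
  | smul f x _ hx => exact hP f (hx trivial)

end Spanning
end TransposeCokernel
end LinearFamily

section Functionals

variable {ι ν S L P M : Type*} [CommRing S] [Field L] [Algebra S L] [CommRing P] [Algebra S P]
  [AddCommGroup M] [Module S M] [Module P M] [IsScalarTower S P M]

theorem eq_zero_of_forall_functional_eq_zero {F : Type*} [Field F] [Algebra P F] [Algebra L F]
    (hspan : Submodule.span L (Set.range (algebraMap P F)) = ⊤) {φ : F →ₗ[L] L} (hφ : φ ≠ 0)
    {z : F} (hz : ∀ f : P, φ (algebraMap P F f * z) = 0) : z = 0 := by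
  by_contra hz0
  have hmul : φ ∘ₗ LinearMap.mulRight L z = 0 :=
    LinearMap.ext_on_range hspan fun f => by simpa using hz f
  exact hφ <| LinearMap.ext fun y => by simpa [hz0] using LinearMap.congr_fun hmul (y * z⁻¹)

/-- The values of a functional on a family of vectors. -/
def evalAt (m : ν → M) : (M →ₗ[S] L) →ₗ[L] ν → L :=
  LinearMap.pi fun q => LinearMap.applyₗ' L (m q)

theorem injective_evalAt {m : ν → M} (hm : Submodule.span S (Set.range m) = ⊤) :
    Function.Injective (evalAt m : (M →ₗ[S] L) →ₗ[L] ν → L) :=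
  fun _ _ h => LinearMap.ext_on_range hm (congrFun h)

variable {F : ι → Type*} [∀ i, Field (F i)] [∀ i, Algebra P (F i)]

theorem exists_algebraMap_ne_zero [Finite ι]
    (hker : ∀ i j, RingHom.ker (algebraMap P (F i)) ≤ RingHom.ker (algebraMap P (F j)) → i = j)
    (i : ι) : ∃ f : P, algebraMap P (F i) f ≠ 0 ∧ ∀ j ≠ i, algebraMap P (F j) f = 0 := by
  classical
  have := Fintype.ofFinite ι
  have hnot : ¬(Finset.univ.erase i).inf (fun j => RingHom.ker (algebraMap P (F j))) ≤
      RingHom.ker (algebraMap P (F i)) := by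
    rw [(RingHom.ker_isPrime (algebraMap P (F i))).inf_le']
    rintro ⟨j, hj, hji⟩
    exact Finset.ne_of_mem_erase hj (hker j i hji)
  obtain ⟨f, hf, hfi⟩ := SetLike.not_le_iff_exists.mp hnot
  refine ⟨f, hfi, fun j hj => ?_⟩
  exact (Submodule.mem_finsetInf.mp hf) j (Finset.mem_erase.mpr ⟨hj, Finset.mem_univ j⟩)

variable [∀ i, Algebra L (F i)] [∀ i, Algebra S (F i)] [∀ i, IsScalarTower S P (F i)]
  [∀ i, IsScalarTower S L (F i)] [∀ i, SMulCommClass P L (F i)] [Fintype ι]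

/-- The map which sends a family of `P`-linear maps `g i : M → F i` to the `S`-linear functional
`∑ i, φ i ∘ g i`. -/
def sumFunctional (φ : ∀ i, F i →ₗ[L] L) :
    (∀ i, M →ₗ[P] F i) →ₗ[L] (M →ₗ[S] L) where
  toFun g := ∑ i, (φ i).restrictScalars S ∘ₗ (g i).restrictScalars S
  map_add' g h := by
    simp [LinearMap.restrictScalars_add, LinearMap.comp_add, Finset.sum_add_distrib]
  map_smul' c g := by
    ext x
    simp [Finset.mul_sum]

@[simp]
theorem sumFunctional_apply (φ : ∀ i, F i →ₗ[L] L) (g : ∀ i, M →ₗ[P] F i) (x : M) :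
    (sumFunctional φ g : M →ₗ[S] L) x = ∑ i, φ i (g i x) := by
  simp [sumFunctional]

theorem injective_sumFunctional {φ : ∀ i, F i →ₗ[L] L} (hφ : ∀ i, φ i ≠ 0)
    (hspan : ∀ i, Submodule.span L (Set.range (algebraMap P (F i))) = ⊤)
    (hker : ∀ i j, RingHom.ker (algebraMap P (F i)) ≤ RingHom.ker (algebraMap P (F j)) → i = j) :
    Function.Injective (sumFunctional φ : (∀ i, M →ₗ[P] F i) →ₗ[L] (M →ₗ[S] L)) := by
  classical
  refine (injective_iff_map_eq_zero _).mpr fun g hg => funext fun i => LinearMap.ext fun x => ?_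
  obtain ⟨f, hfi, hf⟩ := exists_algebraMap_ne_zero hker i
  have hfx : algebraMap P (F i) f * g i x = 0 :=
    eq_zero_of_forall_functional_eq_zero (hspan i) (hφ i) fun a => by
      have h0 := LinearMap.congr_fun hg (a • f • x)
      rw [sumFunctional_apply, Finset.sum_eq_single i (fun j _ hj => by
        simp [Algebra.smul_def, hf j hj]) (by simp)] at h0
      simpa [Algebra.smul_def] using h0
  exact (mul_eq_zero.mp hfx).resolve_left hfi

theorem injective_evalAt_comp_sumFunctional {m : ν → M}
    (hm : Submodule.span S (Set.range m) = ⊤) {φ : ∀ i, F i →ₗ[L] L} (hφ : ∀ i, φ i ≠ 0)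
    (hspan : ∀ i, Submodule.span L (Set.range (algebraMap P (F i))) = ⊤)
    (hker : ∀ i j, RingHom.ker (algebraMap P (F i)) ≤ RingHom.ker (algebraMap P (F j)) → i = j) :
    Function.Injective ((evalAt m : (M →ₗ[S] L) →ₗ[L] ν → L) ∘ₗ
      (sumFunctional φ : (∀ i, M →ₗ[P] F i) →ₗ[L] (M →ₗ[S] L))) :=
  (injective_evalAt hm).comp (injective_sumFunctional hφ hspan hker)

omit [Fintype ι] in
theorem finite_linearMap [Finite ι] [Finite ν] {m : ν → M} (hm : Submodule.span S (Set.range m) = ⊤)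
    (hspan : ∀ i, Submodule.span L (Set.range (algebraMap P (F i))) = ⊤)
    (hker : ∀ i j, RingHom.ker (algebraMap P (F i)) ≤ RingHom.ker (algebraMap P (F j)) → i = j)
    (i : ι) : Module.Finite L (M →ₗ[P] F i) := by
  classical
  have := Fintype.ofFinite ι
  choose φ hφ using fun i => exists_ne (0 : F i →ₗ[L] L)
  exact Module.Finite.of_injective
    ((evalAt m ∘ₗ (sumFunctional φ : _ →ₗ[L] (M →ₗ[S] L))) ∘ₗ
      LinearMap.single L (fun i => M →ₗ[P] F i) i) <|
    (injective_evalAt_comp_sumFunctional hm hφ hspan hker).comp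
      (Pi.single_injective (M := fun i => M →ₗ[P] F i) i)

theorem sum_finrank_linearMap_le [Fintype ν] {m : ν → M}
    (hm : Submodule.span S (Set.range m) = ⊤)
    (hspan : ∀ i, Submodule.span L (Set.range (algebraMap P (F i))) = ⊤)
    (hker : ∀ i j, RingHom.ker (algebraMap P (F i)) ≤ RingHom.ker (algebraMap P (F j)) → i = j) :
    ∑ i, Module.finrank L (M →ₗ[P] F i) ≤ Fintype.card ν := by
  choose φ hφ using fun i => exists_ne (0 : F i →ₗ[L] L)
  have := finite_linearMap (L := L) hm hspan hker
  rw [← Module.finrank_pi_fintype, ← Module.finrank_fintype_fun_eq_card L]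
  exact LinearMap.finrank_le_finrank_of_injective
    (injective_evalAt_comp_sumFunctional hm hφ hspan hker)

theorem iInf_ker_le_annihilator [Fintype ν] {m : ν → M}
    (hm : Submodule.span S (Set.range m) = ⊤)
    (hspan : ∀ i, Submodule.span L (Set.range (algebraMap P (F i))) = ⊤)
    (hker : ∀ i j, RingHom.ker (algebraMap P (F i)) ≤ RingHom.ker (algebraMap P (F j)) → i = j)
    (hL : Function.Injective (algebraMap S L))
    (hcard : ∑ i, Module.finrank L (M →ₗ[P] F i) = Fintype.card ν) :
    ⨅ i, RingHom.ker (algebraMap P (F i)) ≤ Module.annihilator P M := by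
  classical
  choose φ hφ using fun i => exists_ne (0 : F i →ₗ[L] L)
  have := finite_linearMap (L := L) hm hspan hker
  have hsurj : Function.Surjective ((evalAt m : (M →ₗ[S] L) →ₗ[L] ν → L) ∘ₗ
      (sumFunctional φ : (∀ i, M →ₗ[P] F i) →ₗ[L] (M →ₗ[S] L))) := by
    refine (LinearMap.injective_iff_surjective_of_finrank_eq_finrank ?_).mp <|
      injective_evalAt_comp_sumFunctional hm hφ hspan hker
    rw [Module.finrank_pi_fintype, Module.finrank_fintype_fun_eq_card, hcard]
  refine fun f hf => Module.mem_annihilator.mpr fun x => ?_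
  obtain ⟨c, hc⟩ := (Submodule.mem_span_range_iff_exists_fun S).mp <|
    hm ▸ Submodule.mem_top (x := f • x)
  suffices c = 0 by rw [← hc, this]; simp
  funext q
  obtain ⟨g, hg⟩ := hsurj (Pi.single q 1)
  have hcoeff (p : ν) : (sumFunctional φ g : M →ₗ[S] L) (m p) = (Pi.single q 1 : ν → L) p :=
    congrFun hg p
  apply hL
  calc algebraMap S L (c q) = (sumFunctional φ g : M →ₗ[S] L) (∑ p, c p • m p) := by
        rw [map_sum, Finset.sum_eq_single q (fun p _ hp => by
          rw [map_smul, hcoeff, Pi.single_eq_of_ne hp, smul_zero]) (by simp), map_smul, hcoeff,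
          Pi.single_eq_same, Algebra.algebraMap_eq_smul_one]
    _ = algebraMap S L 0 := by
        have hfi (i : ι) : algebraMap P (F i) f = 0 := (Submodule.mem_iInf _).mp hf i
        simp [hc, Algebra.smul_def, hfi]

end Functionals

section CoordFamily

theorem finrank_le_finrank_of_injective_of_isFractionRing {R F N V : Type*} [CommRing R] [Field F]
    [Algebra R F] [IsFractionRing R F] [AddCommGroup N] [Module R N] [AddCommGroup V]
    [Module R V] [Module F V] [IsScalarTower R F V] [Module.Finite F V] {i : N →ₗ[R] V}
    (hi : Function.Injective i) : Module.finrank R N ≤ Module.finrank F V := by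
  have hrank := IsLocalization.rank_eq F (N := V) R⁰ le_rfl
  have hle := LinearMap.lift_rank_le_of_injective i hi
  rw [← hrank] at hle
  simpa [Module.finrank] using Cardinal.toNat_le_toNat hle
    (Cardinal.lift_lt_aleph0.mpr (Module.rank_lt_aleph0 F V))

open MvPolynomial

variable {K σ W ν : Type*} [Field K] [Fintype ν] [DecidableEq ν]
  (R : Type*) [CommRing R] [Algebra K R] [Algebra (MvPolynomial σ K) R]

/-- A vector with entries in `R` as a functional on row vectors of polynomials. -/
def dotProductHom : R ⊗[K] (ν → K) →ₗ[R] (ν → MvPolynomial σ K) →ₗ[MvPolynomial σ K] R :=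
  Fintype.bilinearCombination (MvPolynomial σ K) R ∘ₗ
    (TensorProduct.piScalarRight K R R ν).toLinearMap

theorem dotProductHom_tmul (r : R) (u : ν → K) (f : ν → MvPolynomial σ K) :
    dotProductHom R (r ⊗ₜ u) f = ∑ p, f p • u p • r := by
  simp [dotProductHom, Fintype.bilinearCombination_apply, Fintype.linearCombination_apply]

theorem injective_dotProductHom :
    Function.Injective (dotProductHom R :
      R ⊗[K] (ν → K) →ₗ[R] (ν → MvPolynomial σ K) →ₗ[MvPolynomial σ K] R) := by
  refine fun y z h => (TensorProduct.piScalarRight K R R ν).injective <| _root_.funext fun p => ?_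
  simpa [dotProductHom, Fintype.bilinearCombination_apply, Fintype.linearCombination_apply] using
    LinearMap.congr_fun h (Pi.single p 1)

variable [AddCommGroup W] [Module K W] [Fintype σ] [DecidableEq σ]
  (B : (σ → K) →ₗ[K] (ν → K) →ₗ[K] W)

/-- The linear family `B` at the tautological point `(x_j)_j` of a `K[x]`-algebra `R`. -/
def coordFamily : R ⊗[K] (ν → K) →ₗ[R] R ⊗[K] W :=
  ∑ j, algebraMap (MvPolynomial σ K) R (X j) • (B (Pi.single j 1)).baseChange R

variable [IsScalarTower K (MvPolynomial σ K) R]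

theorem dotProductHom_relation (θ : Module.Dual K W) (z : R ⊗[K] (ν → K)) :
    dotProductHom R z (relation B θ) =
      θ.baseChange R (coordFamily R B z) := by
  induction z with
  | zero => simp
  | add y z hy hz => simp only [map_add, LinearMap.add_apply, hy, hz]
  | tmul r u =>
    have hB (j : σ) :
        θ (B (Pi.single j 1) u) = ∑ p, u p * θ (B (Pi.single j 1) (Pi.single p 1)) := by
      conv_lhs => rw [pi_eq_sum_univ' u]
      simp
    simp only [dotProductHom_tmul, relation, linForm_apply, pairing_apply, coordFamily,
      LinearMap.sum_apply, LinearMap.smul_apply, LinearMap.baseChange_tmul, map_sum, map_smul,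
      Module.Dual.baseChange_apply_tmul, hB, Finset.sum_smul]
    rw [Finset.sum_comm]
    refine Finset.sum_congr rfl fun j _ => ?_
    rw [algebraMap_smul, Finset.smul_sum]
    refine Finset.sum_congr rfl fun p _ => ?_
    rw [smul_assoc, smul_comm _ (X j), smul_smul, mul_comm]

variable {R} in
theorem span_relation_le_ker_dotProductHom {z : R ⊗[K] (ν → K)} (hz : coordFamily R B z = 0) :
    Submodule.span (MvPolynomial σ K) (Set.range (relation B)) ≤
      LinearMap.ker (dotProductHom R z) := by
  rw [Submodule.span_le]
  rintro _ ⟨θ, rfl⟩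
  simp [dotProductHom_relation, hz]

/-- A vector in the kernel of the tautological map as a functional on the cokernel of the
transpose. -/
def kernelToDual : LinearMap.ker (coordFamily R B) →ₗ[R]
    (TransposeCokernel B →ₗ[MvPolynomial σ K] R) where
  toFun z := Submodule.liftQ _ (dotProductHom R z.1) (span_relation_le_ker_dotProductHom B z.2)
  map_add' y z := by ext; simp
  map_smul' r z := by ext; simp

theorem injective_kernelToDual : Function.Injective (kernelToDual R B) := by
  refine fun y z h => Subtype.ext (injective_dotProductHom (σ := σ) R ?_)
  exact LinearMap.ext fun f => LinearMap.congr_fun h (Submodule.Quotient.mk f)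

omit [Fintype ν] in
theorem finrank_kernel_coordFamily_le [Finite ν] (F : Type*) [Field F] [Algebra R F]
    [IsFractionRing R F] [Algebra (MvPolynomial σ K) F] [IsScalarTower (MvPolynomial σ K) R F] :
    Module.finrank F (F ⊗[R] LinearMap.ker (coordFamily R B)) ≤
      Module.finrank F (TransposeCokernel B →ₗ[MvPolynomial σ K] F) := by
  have := Fintype.ofFinite ν
  have : FaithfulSMul R F :=
    (faithfulSMul_iff_algebraMap_injective R F).mpr (IsFractionRing.injective R F)
  have : Module.Finite F (TransposeCokernel B →ₗ[MvPolynomial σ K] F) :=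
    Module.Finite.of_injective (evalAt (TransposeCokernel.gen B))
      (injective_evalAt (TransposeCokernel.span_gen B))
  let N := LinearMap.ker (coordFamily R B)
  rw [IsBaseChange.finrank_eq (M := N) (P := F ⊗[R] N) (TensorProduct.isBaseChange R N F)]
  let toFractions : (TransposeCokernel B →ₗ[MvPolynomial σ K] R) →ₗ[R]
      (TransposeCokernel B →ₗ[MvPolynomial σ K] F) :=
    { toFun := fun g => (IsScalarTower.toAlgHom (MvPolynomial σ K) R F).toLinearMap ∘ₗ g
      map_add' := fun g h => LinearMap.comp_add _ _ _
      map_smul' := fun r g => LinearMap.ext fun x => by simp [Algebra.smul_def] }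
  have htoFractions : Function.Injective toFractions := fun g h hgh =>
    LinearMap.ext fun x => IsFractionRing.injective R F (LinearMap.congr_fun hgh x)
  exact finrank_le_finrank_of_injective_of_isFractionRing (N := N)
    (V := TransposeCokernel B →ₗ[MvPolynomial σ K] F) (i := toFractions ∘ₗ kernelToDual R B)
    (htoFractions.comp (injective_kernelToDual R B))

end CoordFamily

section Wedge

open ExteriorAlgebra

variable {d k n : ℕ} (γ : Tensor d k n)

/-- The linear family `μ ↦ γ ∧ μ` of linear maps `ℂ^n → ∧ℂ^{d+1} ⊗ ℂ^n`. -/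
def wedgeFamily : (Fin (d + 1) → ℂ) →ₗ[ℂ] (Fin n → ℂ) →ₗ[ℂ] Ext d ⊗[ℂ] (Fin n → ℂ) :=
  ((LinearMap.lTensorHom (Ext d)).comp (Matrix.mulVecBilin ℂ ℂ).flip).flip ∘ₗ
    (LinearMap.rTensorHom (Matrix (Fin n) (Fin n) ℂ) ∘ₗ
      LinearMap.lcomp ℂ (Ext d) (⋀[ℂ]^(k + 1) (Fin (d + 1) → ℂ)).subtype ∘ₗ
        (LinearMap.mul ℂ (Ext d)).flip).flip γ ∘ₗ ι ℂ

theorem wedgeFamily_apply (μ : Fin (d + 1) → ℂ) : wedgeFamily γ μ = toMap (wedge γ (ι ℂ μ)) :=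
  rfl

theorem coordWedge_eq_coordFamily (X : Set (PP d)) :
    coordWedge γ X = coordFamily (CoordRing X) (wedgeFamily γ) := rfl

theorem toMap_wedge_mul (η ω : Ext d) (u : Fin n → ℂ) :
    toMap (wedge γ (η * ω)) u =
      LinearMap.rTensor _ (LinearMap.mulRight ℂ ω) (toMap (wedge γ η) u) := by
  induction γ using TensorProduct.induction_on with
  | zero => simp [wedge, toMap]
  | tmul η A => simp [mul_assoc]
  | add a b ha hb => simp_all [wedge, toMap]

theorem exists_ιMulti_update_eq_ι_mul {m : ℕ} (v : Fin m → Fin (d + 1) → ℂ) (i : Fin m) :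
    ∃ ω : Ext d, ∀ μ, ιMulti ℂ m (Function.update v i μ) = ι ℂ μ * ω := by
  obtain _ | m := m
  · exact i.elim0
  refine ⟨(-1) ^ (i : ℕ) • ιMulti ℂ m (i.removeNth v), fun μ => ?_⟩
  rw [← Fin.insertNth_removeNth, AlternatingMap.map_insertNth, ιMulti_succ_apply, mul_smul_comm]
  rfl

/-- A functional on the exterior algebra which takes the value `1` at `e_0 ∧ ⋯ ∧ e_d`. -/
def volForm (d : ℕ) : Module.Dual ℂ (Ext d) :=
  liftAlternating (Function.update (β := fun i => (Fin (d + 1) → ℂ) [⋀^Fin i]→ₗ[ℂ] ℂ) 0 (d + 1)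
    Matrix.detRowAlternating)

theorem volForm_ιMulti_single (d : ℕ) :
    volForm d (ιMulti ℂ (d + 1) fun i => Pi.single i 1) = 1 := by
  have hone : (fun i => Pi.single i 1 : Fin (d + 1) → Fin (d + 1) → ℂ) = (1 : Matrix _ _ ℂ) := by
    ext i j
    simp [Matrix.one_apply, Pi.single_apply, eq_comm]
  rw [volForm, liftAlternating_apply_ιMulti, Function.update_self, hone]
  exact Matrix.det_one

theorem exists_contractions {m : ℕ} {v : Fin m → Fin (d + 1) → ℂ}
    {A : Matrix (Fin n) (Fin n) ℂ} (hA : IsUnit A)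
    (hv : wedge γ (ιMulti ℂ m v) = ιMulti ℂ (d + 1) (fun i => Pi.single i 1) ⊗ₜ[ℂ] A) :
    ∃ Θ : Fin m → Ext d ⊗[ℂ] (Fin n → ℂ) →ₗ[ℂ] Fin n → ℂ,
      ∀ i i' u, Θ i (wedgeFamily γ (v i') u) = if i = i' then u else 0 := by
  choose ω hω using exists_ιMulti_update_eq_ι_mul v
  refine ⟨fun i => A⁻¹.mulVecLin ∘ₗ (TensorProduct.lid ℂ _).toLinearMap ∘ₗ
    LinearMap.rTensor _ (volForm d) ∘ₗ LinearMap.rTensor _ (LinearMap.mulRight ℂ (ω i)),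
    fun i i' u => ?_⟩
  simp only [LinearMap.comp_apply, wedgeFamily_apply, ← toMap_wedge_mul, ← hω]
  split_ifs with h
  · subst h
    have hdet : IsUnit A.det := (Matrix.isUnit_iff_isUnit_det A).mp hA
    rw [Function.update_eq_self, hv]
    simp [-ιMulti_succ_apply, volForm_ιMulti_single, Matrix.nonsing_inv_mul A hdet]
  · rw [(ιMulti ℂ m).map_update_self v h]
    simp [wedge, toMap]

theorem exists_basis_inl_eq {K V : Type*} [Field K] [AddCommGroup V] [Module K V]
    [FiniteDimensional K V] {m l : ℕ} {v : Fin m → V} (hv : LinearIndependent K v)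
    (hml : m + l = Module.finrank K V) :
    ∃ b : Module.Basis (Fin m ⊕ Fin l) K V, ∀ i, b (.inl i) = v i := by
  have : Finite (Fin m ⊕ Module.Basis.sumExtendIndex hv) :=
    Module.Finite.finite_basis (Module.Basis.sumExtend hv)
  have : Finite (Module.Basis.sumExtendIndex hv) := Finite.sum_right (Fin m)
  have : Fintype (Module.Basis.sumExtendIndex hv) := Fintype.ofFinite _
  have hcard := Module.finrank_eq_card_basis (Module.Basis.sumExtend hv)
  rw [Fintype.card_sum, Fintype.card_fin] at hcard
  let e : Module.Basis.sumExtendIndex hv ≃ Fin l := Fintype.equivFinOfCardEq (by omega)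
  refine ⟨(Module.Basis.sumExtend hv).reindex ((Equiv.refl _).sumCongr e), fun i => ?_⟩
  simp [Module.Basis.sumExtend]
  rfl

end Wedge

section FiniteExtension

theorem injective_algebraMap_of_ringKrullDim_le {A B : Type*} [CommRing A] [IsDomain A]
    [CommRing B] [Algebra A B] [Algebra.IsIntegral A B] {r : ℕ} (hA : ringKrullDim A = r)
    (h : r ≤ ringKrullDim B) : Function.Injective (algebraMap A B) := by
  refine (injective_iff_map_eq_zero _).mpr fun a ha => ?_
  by_contra ha0
  obtain ⟨l, hl⟩ := Order.le_krullDim_iff.mp h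
  have hmono : StrictMono (PrimeSpectrum.comap (algebraMap A B)) := fun p q hpq =>
    have := p.isPrime
    Ideal.IsIntegral.comap_lt_comap (show p.asIdeal < q.asIdeal from hpq)
  have hbot : ⊥ < PrimeSpectrum.comap (algebraMap A B) l.head :=
    bot_lt_iff_ne_bot.mpr fun hp => ha0 <| by
      have : a ∈ (PrimeSpectrum.comap (algebraMap A B) l.head).asIdeal := by simp [ha]
      simpa [hp] using this
  let chain : LTSeries (PrimeSpectrum A) := (l.map _ hmono).cons ⊥ hbot
  have hlength : chain.length = l.length + 1 := RelSeries.cons_length _ _ _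
  have hle := Order.LTSeries.length_le_krullDim chain
  rw [← ringKrullDim, hA, Nat.cast_le] at hle
  omega

variable {S P M : Type*} [CommRing S] [CommRing P] [Algebra S P] [AddCommGroup M] [Module S M]
  [Module P M] [IsScalarTower S P M]

theorem finite_quotient_of_annihilator_le [IsNoetherianRing S] [Module.Finite S M] {I : Ideal P}
    (hI : Module.annihilator P M ≤ I) : Module.Finite S (P ⧸ I) := by
  let act : P →ₐ[S] Module.End S M := Algebra.lsmul S S M
  have hker : RingHom.ker act ≤ I := fun f hf =>
    hI <| Module.mem_annihilator.mpr <| LinearMap.congr_fun hf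
  have : Module.Finite S (P ⧸ RingHom.ker act) :=
    Module.Finite.of_injective (Ideal.kerLiftAlg act).toLinearMap (Ideal.kerLiftAlg_injective act)
  exact Module.Finite.of_surjective (Ideal.Quotient.factorₐ S hker).toLinearMap
    (Ideal.Quotient.factor_surjective hker)

attribute [local instance] FractionRing.liftAlgebra

theorem span_range_algebraMap_fractionRing_quotient (I : Ideal P) [I.IsPrime]
    [FaithfulSMul S (P ⧸ I)] [Algebra.IsAlgebraic S (P ⧸ I)] :
    Submodule.span (FractionRing S) (Set.range (algebraMap P (FractionRing (P ⧸ I)))) = ⊤ := by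
  have h := span_eq_top_of_isLocalizedModule (FractionRing S) (nonZeroDivisors S)
    (IsScalarTower.toAlgHom S (P ⧸ I) (FractionRing (P ⧸ I))).toLinearMap
    (Submodule.span_univ (R := S) (M := P ⧸ I))
  rw [← Ideal.Quotient.mk_surjective.range_eq, ← Set.range_comp] at h
  exact h

variable {ι ν : Type*} [Fintype ι] [Fintype ν] [IsDomain S] {m : ν → M} {I : ι → Ideal P}
  [∀ i, (I i).IsPrime] [∀ i, FaithfulSMul S (P ⧸ I i)] [∀ i, Algebra.IsAlgebraic S (P ⧸ I i)]

theorem ker_algebraMap_fractionRing_quotient (J : Ideal P) :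
    RingHom.ker (algebraMap P (FractionRing (P ⧸ J))) = J := by
  rw [IsScalarTower.algebraMap_eq P (P ⧸ J), RingHom.ker_comp_of_injective _
    (IsFractionRing.injective (P ⧸ J) (FractionRing (P ⧸ J))), Ideal.Quotient.algebraMap_eq,
    Ideal.mk_ker]

omit [Module S M] [IsScalarTower S P M] in
theorem finrank_linearMap_fractionRing_quotient (J : Ideal P) [J.IsPrime]
    [FaithfulSMul S (P ⧸ J)] :
    Module.finrank (FractionRing S) (M →ₗ[P] FractionRing (P ⧸ J)) =
      Module.finrank S (P ⧸ J) *
        Module.finrank (FractionRing (P ⧸ J)) (M →ₗ[P] FractionRing (P ⧸ J)) := by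
  rw [← Module.finrank_mul_finrank (FractionRing S) (FractionRing (P ⧸ J)),
    IsFractionRing.finrank_eq S (FractionRing S) (P ⧸ J) (FractionRing (P ⧸ J))]

theorem sum_finrank_mul_finrank_le (hm : Submodule.span S (Set.range m) = ⊤)
    (hI : ∀ i j, I i ≤ I j → i = j) :
    ∑ i, Module.finrank S (P ⧸ I i) *
      Module.finrank (FractionRing (P ⧸ I i)) (M →ₗ[P] FractionRing (P ⧸ I i)) ≤
        Fintype.card ν := by
  simp only [← finrank_linearMap_fractionRing_quotient]
  exact sum_finrank_linearMap_le hm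
    (fun i => span_range_algebraMap_fractionRing_quotient (I i))
    (by simpa only [ker_algebraMap_fractionRing_quotient] using hI)

theorem iInf_le_annihilator (hm : Submodule.span S (Set.range m) = ⊤)
    (hI : ∀ i j, I i ≤ I j → i = j)
    (hcard : ∑ i, Module.finrank S (P ⧸ I i) *
      Module.finrank (FractionRing (P ⧸ I i)) (M →ₗ[P] FractionRing (P ⧸ I i)) =
        Fintype.card ν) :
    ⨅ i, I i ≤ Module.annihilator P M := by
  simp only [← finrank_linearMap_fractionRing_quotient] at hcard
  simpa only [ker_algebraMap_fractionRing_quotient] using iInf_ker_le_annihilator hm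
    (fun i => span_range_algebraMap_fractionRing_quotient (I i))
    (by simpa only [ker_algebraMap_fractionRing_quotient] using hI)
    (IsFractionRing.injective S (FractionRing S)) hcard

end FiniteExtension

section HilbertFunction

open MvPolynomial

theorem finrank_homogeneousSubmodule (K : Type*) [Field K] (k m : ℕ) :
    Module.finrank K (homogeneousSubmodule (Fin (k + 1)) K m) = (m + k).choose k := by
  classical
  have hfinset : {s : Fin (k + 1) →₀ ℕ | s.degree = m} =
      (Finset.univ.finsuppAntidiag m : Finset (Fin (k + 1) →₀ ℕ)) := by
    ext s
    simp [Finset.mem_finsuppAntidiag, Finsupp.degree_eq_sum]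
  rw [homogeneousSubmodule_eq_finsupp_supported,
    (AddMonoidAlgebra.supportedEquivFinsupp _).finrank_eq, hfinset, Module.finrank_finsupp_self]
  simp only [Finset.coe_sort_coe, Fintype.card_coe]
  rw [Finset.card_finsuppAntidiag_nat_eq_choose, Finset.card_univ, Fintype.card_fin,
    show k + 1 + m - 1 = m + k by omega, ← Nat.choose_symm_add]

theorem finite_homogeneousSubmodule (σ K : Type*) [Finite σ] [Field K] (m : ℕ) :
    Module.Finite K (homogeneousSubmodule σ K m) :=
  Module.Finite.iff_fg.mpr (homogeneousSubmodule_fg _ _ m)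

open Asymptotics in
theorem tendsto_factorial_mul_finrank_homogeneousSubmodule (K : Type*) [Field K] (k a b : ℕ) :
    Tendsto (fun m : ℕ => (k.factorial : ℝ) *
      Module.finrank K (homogeneousSubmodule (Fin (k + 1)) K (m + a - b)) / (m : ℝ) ^ k)
      atTop (𝓝 1) := by
  have htop : Tendsto (fun m => m + a - b + k) atTop atTop :=
    tendsto_atTop_mono (fun m => show m - b ≤ m + a - b + k by omega) (tendsto_sub_atTop_nat b)
  have hshift : (fun m : ℕ => ((m + a - b + k : ℕ) : ℝ)) ~[atTop] fun m : ℕ => (m : ℝ) := by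
    refine IsLittleO.congr' (isLittleO_const_left.mpr (.inr ?_))
      (f₁ := fun _ : ℕ => (a - b + k : ℝ)) ?_ .rfl
    · exact tendsto_norm_atTop_atTop.comp tendsto_natCast_atTop_atTop
    · filter_upwards [eventually_ge_atTop b] with m hm
      simp only [Pi.sub_apply]
      rw [Nat.cast_add, Nat.cast_sub (by omega), Nat.cast_add]
      ring
  have hchoose := (isEquivalent_choose k).comp_tendsto htop |>.trans <|
    (hshift.pow k).div (IsEquivalent.refl (u := fun _ => (k.factorial : ℝ)))
  have hequiv := (isEquivalent_iff_tendsto_one ?_).mp hchoose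
  · refine hequiv.congr fun m => ?_
    rw [finrank_homogeneousSubmodule]
    simp only [Pi.div_apply, Function.comp_apply, Pi.pow_apply]
    rw [div_div_eq_mul_div, mul_comm]
  · filter_upwards [eventually_gt_atTop 0] with m hm
    simp only [Pi.div_apply, Pi.pow_apply]
    positivity

theorem exists_linearIndependent_of_span_eq_top {S N : Type*} [CommRing S] [IsDomain S]
    [AddCommGroup N] [Module S N] [Module.Finite S N] {G : Set N}
    (hG : Submodule.span S G = ⊤) :
    ∃ a : Fin (Module.finrank S N) → N, (∀ i, a i ∈ G) ∧ LinearIndependent S a ∧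
      ∃ s : S, s ≠ 0 ∧ ∀ b, s • b ∈ Submodule.span S (Set.range a) := by
  obtain ⟨T, hT, hmax⟩ := exists_maximal_linearIndepOn S (Subtype.val : G → N)
  have : Fintype T := @Fintype.ofFinite T (LinearIndependent.finite hT)
  set L := Submodule.span S (Subtype.val '' T : Set N) with hL
  have htorsion : Module.IsTorsion S (N ⧸ L) := by
    refine (Submodule.isTorsion'_iff_torsion'_eq_top (R := S) (nonZeroDivisors S)).mpr
      (eq_top_iff.mpr ?_)
    rw [← L.range_mkQ, LinearMap.range_eq_map, ← hG, Submodule.map_span_le]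
    intro g hg
    by_cases hgT : (⟨g, hg⟩ : G) ∈ T
    · have hgL : g ∈ L := Submodule.subset_span ⟨_, hgT, rfl⟩
      rw [Submodule.mkQ_apply, (Submodule.Quotient.mk_eq_zero L).mpr hgL]
      exact Submodule.zero_mem _
    · obtain ⟨s, hs, hsg⟩ := hmax _ hgT
      exact ⟨⟨s, mem_nonZeroDivisors_of_ne_zero hs⟩, (Submodule.Quotient.mk_eq_zero L).mpr hsg⟩
  obtain ⟨s, hsann, hs⟩ := Submodule.annihilator_top_inter_nonZeroDivisors htorsion
  have hcard : Fintype.card T = Module.finrank S N := by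
    have := L.finrank_quotient_add_finrank
    rw [Module.finrank_eq_zero_iff_isTorsion.mpr htorsion, zero_add, hL, Set.image_eq_range,
      finrank_span_eq_card hT] at this
    exact this
  let e := Fintype.equivFinOfCardEq hcard
  refine ⟨fun i => (e.symm i : G), fun i => (e.symm i : G).2, hT.comp _ e.symm.injective, s,
    nonZeroDivisors.ne_zero hs, fun b => ?_⟩
  have hrange : Set.range (fun i => ((e.symm i : G) : N)) = Subtype.val '' T := by
    rw [Set.image_eq_range]
    exact e.symm.surjective.range_comp (fun t : T => ((t : G) : N))
  rw [hrange, ← Submodule.Quotient.mk_eq_zero, Submodule.Quotient.mk_smul]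
  exact Submodule.mem_annihilator.mp hsann _ trivial

theorem span_isHomogeneousElem_eq_top {ι R S N : Type*} [DecidableEq ι] [Semiring R]
    [Semiring S] [AddCommMonoid N] [Module R N] [Module S N] (𝒩 : ι → Submodule R N)
    [DirectSum.Decomposition 𝒩] :
    Submodule.span S {b | SetLike.IsHomogeneousElem 𝒩 b} = ⊤ := by
  refine eq_top_iff.mpr fun b _ => ?_
  induction b using DirectSum.Decomposition.inductionOn 𝒩 with
  | zero => exact Submodule.zero_mem _
  | homogeneous b => exact Submodule.subset_span ⟨_, b.2⟩
  | add b c hb hc => exact Submodule.add_mem _ (hb trivial) (hc trivial)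

section GradedModule

attribute [local instance] MvPolynomial.gradedAlgebra

variable {K N : Type*} [Field K] {k : ℕ} [AddCommGroup N] [Module K N]
  [Module (MvPolynomial (Fin (k + 1)) K) N] [IsScalarTower K (MvPolynomial (Fin (k + 1)) K) N]
  (𝒩 : ℕ → Submodule K N)
  [SetLike.GradedSMul (homogeneousSubmodule (Fin (k + 1)) K) 𝒩]

theorem sum_finrank_homogeneousSubmodule_le {ι : Type*} [Fintype ι] {a : ι → N} {e : ι → ℕ}
    (ha : LinearIndependent (MvPolynomial (Fin (k + 1)) K) a) (hae : ∀ i, a i ∈ 𝒩 (e i)) {m : ℕ}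
    [Module.Finite K (𝒩 m)] (hm : ∀ i, e i ≤ m) :
    ∑ i, Module.finrank K (homogeneousSubmodule (Fin (k + 1)) K (m - e i)) ≤
      Module.finrank K (𝒩 m) := by
  have (i : ℕ) := finite_homogeneousSubmodule (Fin (k + 1)) K i
  let combine : (∀ i, homogeneousSubmodule (Fin (k + 1)) K (m - e i)) →ₗ[K] N :=
    (Fintype.linearCombination (MvPolynomial (Fin (k + 1)) K) a).restrictScalars K ∘ₗ
      LinearMap.piMap fun i => (homogeneousSubmodule (Fin (k + 1)) K (m - e i)).subtype
  have hmem (p) : combine p ∈ 𝒩 m := Submodule.sum_mem _ fun i _ => by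
    have := SetLike.GradedSMul.smul_mem (p i).2 (hae i)
    rwa [vadd_eq_add, Nat.sub_add_cancel (hm i)] at this
  have hinj : Function.Injective (combine.codRestrict _ hmem) := by
    rw [← LinearMap.ker_eq_bot, LinearMap.ker_codRestrict, LinearMap.ker_eq_bot]
    exact ha.fintypeLinearCombination_injective.comp <|
      Function.Injective.piMap fun i => Subtype.val_injective
  simpa only [Module.finrank_pi_fintype] using LinearMap.finrank_le_finrank_of_injective hinj

variable [DirectSum.Decomposition 𝒩]

omit [IsScalarTower K (MvPolynomial (Fin (k + 1)) K) N] in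
theorem decompose_smul_of_mem {j m : ℕ} (hjm : j ≤ m) {b : N} (hb : b ∈ 𝒩 j)
    (p : MvPolynomial (Fin (k + 1)) K) :
    (DirectSum.decompose 𝒩 (p • b) m : N) = homogeneousComponent (m - j) p • b := by
  induction p using DirectSum.Decomposition.inductionOn (homogeneousSubmodule (Fin (k + 1)) K) with
  | zero => simp
  | @homogeneous i p =>
    have hpb := SetLike.GradedSMul.smul_mem p.2 hb
    rw [homogeneousComponent_of_mem p.2]
    by_cases h : m = i + j
    · rw [if_pos (by omega), h]
      exact DirectSum.decompose_of_mem_same 𝒩 hpb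
    · rw [if_neg (by omega), zero_smul]
      exact DirectSum.decompose_of_mem_ne 𝒩 hpb (Ne.symm h)
  | add p q hp hq => simp [add_smul, hp, hq]

theorem exists_injective_pi_homogeneousSubmodule
    [Module.IsTorsionFree (MvPolynomial (Fin (k + 1)) K) N]
    {ι : Type*} [Finite ι] {a : ι → N} {e : ι → ℕ}
    (ha : LinearIndependent (MvPolynomial (Fin (k + 1)) K) a) (hae : ∀ i, a i ∈ 𝒩 (e i))
    {s : MvPolynomial (Fin (k + 1)) K} {D : ℕ} (hD : homogeneousComponent D s ≠ 0)
    (hsa : ∀ b, s • b ∈ Submodule.span (MvPolynomial (Fin (k + 1)) K) (Set.range a))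
    {m : ℕ} (hm : ∀ i, e i ≤ m) :
    ∃ g : 𝒩 m →ₗ[K] ∀ i, homogeneousSubmodule (Fin (k + 1)) K (m + D - e i),
      Function.Injective g := by
  have := Fintype.ofFinite ι
  let coords : N →ₗ[K] ι →₀ MvPolynomial (Fin (k + 1)) K :=
    (ha.repr ∘ₗ (LinearMap.lsmul _ N s).codRestrict _ hsa).restrictScalars K
  have hcoords (b) : s • b = ∑ i, coords b i • a i := by
    exact (ha.linearCombination_repr ⟨s • b, hsa b⟩).symm.trans <|
      Finsupp.sum_fintype _ _ fun i => zero_smul _ (a i)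
  let g (i : ι) : 𝒩 m →ₗ[K] homogeneousSubmodule (Fin (k + 1)) K (m + D - e i) :=
    (homogeneousComponent (m + D - e i) ∘ₗ Finsupp.lapply i ∘ₗ coords ∘ₗ
      (𝒩 m).subtype).codRestrict _ fun b => homogeneousComponent_mem _ _
  refine ⟨LinearMap.pi g, (injective_iff_map_eq_zero _).mpr fun b hb => ?_⟩
  have hzero (i) : homogeneousComponent (m + D - e i) (coords b i) = 0 :=
    congrArg Subtype.val (congrFun hb i)
  have htop := congrArg (fun x => (DirectSum.decompose 𝒩 x (m + D) : N)) (hcoords b)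
  rw [DirectSum.decompose_sum, DFinsupp.finsetSum_apply, AddSubmonoidClass.coe_finsetSum,
    decompose_smul_of_mem 𝒩 (Nat.le_add_right m D) b.2, Nat.add_sub_cancel_left,
    Finset.sum_eq_zero fun i _ => by
      rw [decompose_smul_of_mem 𝒩 ((hm i).trans (Nat.le_add_right m D)) (hae i), hzero,
        zero_smul]] at htop
  exact Subtype.ext ((smul_eq_zero.mp htop).resolve_left hD)

theorem tendsto_factorial_mul_finrank_div_pow
    [Module.Finite (MvPolynomial (Fin (k + 1)) K) N]
    [Module.IsTorsionFree (MvPolynomial (Fin (k + 1)) K) N] :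
    Tendsto (fun m : ℕ => (k.factorial : ℝ) * Module.finrank K (𝒩 m) / (m : ℝ) ^ k) atTop
      (𝓝 (Module.finrank (MvPolynomial (Fin (k + 1)) K) N)) := by
  obtain ⟨a, hahom, ha, s, hs, hsa⟩ := exists_linearIndependent_of_span_eq_top
    (S := MvPolynomial (Fin (k + 1)) K) (span_isHomogeneousElem_eq_top 𝒩)
  choose e hae using hahom
  obtain ⟨D, hD⟩ : ∃ D, homogeneousComponent D s ≠ 0 := by
    by_contra! h
    exact hs (by rw [← sum_homogeneousComponent s, Finset.sum_eq_zero fun i _ => h i])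
  have := fun i => finite_homogeneousSubmodule (Fin (k + 1)) K i
  have hupper (m) (hm : ∀ i, e i ≤ m) : Module.Finite K (𝒩 m) ∧ Module.finrank K (𝒩 m) ≤
      ∑ i, Module.finrank K (homogeneousSubmodule (Fin (k + 1)) K (m + D - e i)) := by
    obtain ⟨g, hg⟩ := exists_injective_pi_homogeneousSubmodule 𝒩 ha hae hD hsa hm
    refine ⟨Module.Finite.of_injective g hg, ?_⟩
    simpa only [Module.finrank_pi_fintype] using LinearMap.finrank_le_finrank_of_injective hg
  have hlower (m) (hm : ∀ i, e i ≤ m) :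
      ∑ i, Module.finrank K (homogeneousSubmodule (Fin (k + 1)) K (m - e i)) ≤
        Module.finrank K (𝒩 m) :=
    have := (hupper m hm).1
    sum_finrank_homogeneousSubmodule_le 𝒩 ha hae hm
  have hlimit (a : ℕ) : Tendsto (fun m : ℕ => (k.factorial : ℝ) *
      (∑ i, Module.finrank K (homogeneousSubmodule (Fin (k + 1)) K (m + a - e i)) : ℕ) /
        (m : ℝ) ^ k) atTop (𝓝 (Module.finrank (MvPolynomial (Fin (k + 1)) K) N)) := by
    have := tendsto_finsetSum Finset.univ fun i _ =>
      tendsto_factorial_mul_finrank_homogeneousSubmodule K k a (e i)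
    simpa only [Nat.cast_sum, Finset.mul_sum, Finset.sum_div, Finset.sum_const, Finset.card_univ,
      Fintype.card_fin, nsmul_eq_mul, mul_one] using this
  have hlarge : ∀ᶠ m in atTop, ∀ i, e i ≤ m :=
    eventually_all.mpr fun i => eventually_ge_atTop (e i)
  refine tendsto_of_tendsto_of_tendsto_of_le_of_le' (hlimit 0) (hlimit D) ?_ ?_
  · filter_upwards [hlarge] with m hm
    gcongr
    exact hlower m hm
  · filter_upwards [hlarge] with m hm
    gcongr
    exact (hupper m hm).2

end GradedModule
section MapDecomposition

open DirectSum

variable {ι R M N : Type*} [DecidableEq ι] [CommRing R] [AddCommGroup M] [Module R M]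
  [AddCommGroup N] [Module R N] (ℳ : ι → Submodule R M) [Decomposition ℳ] {f : M →ₗ[R] N}

/-- The grading of `N` induced by a surjection from a graded module with homogeneous kernel. -/
abbrev mapDecomposition (hf : Function.Surjective f)
    (hker : ∀ x ∈ LinearMap.ker f, ∀ i, f (decompose ℳ x i) = 0) :
    Decomposition fun i => (ℳ i).map f :=
  let components : M →ₗ[R] ⨁ i, (ℳ i).map f :=
    lmap (fun i => f.submoduleMap (ℳ i)) ∘ₗ (decomposeLinearEquiv ℳ).toLinearMap
  have hle : LinearMap.ker f ≤ LinearMap.ker components := fun x hx =>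
    DFinsupp.ext fun i => Subtype.ext (hker x hx i)
  let e := f.quotKerEquivOfSurjective hf
  have he (x : M) : (Submodule.liftQ _ components hle) (e.symm (f x)) = components x := by
    rw [show e.symm (f x) = Submodule.Quotient.mk x from e.symm_apply_eq.mpr rfl]
    rfl
  .ofLinearMap _ (Submodule.liftQ _ components hle ∘ₗ e.symm.toLinearMap)
    (by
      refine LinearMap.ext fun y => ?_
      obtain ⟨x, rfl⟩ := hf y
      change coeLinearMap _ (Submodule.liftQ _ components hle (e.symm (f x))) = f x
      rw [he]
      induction x using Decomposition.inductionOn ℳ with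
      | zero => rw [map_zero, map_zero, map_zero]
      | homogeneous x =>
        simp only [components, LinearMap.comp_apply, LinearEquiv.coe_coe,
          decomposeLinearEquiv_apply, decompose_coe]
        exact (congrArg _ (lmap_lof _ _ _)).trans (coeLinearMap_lof _ _ _)
      | add x y hx hy => rw [map_add, map_add, map_add, hx, hy])
    (by
      ext i ⟨_, x, hx, rfl⟩ : 2
      simp only [LinearMap.comp_apply, coeLinearMap_lof]
      refine (he x).trans ?_
      simp only [components, LinearMap.comp_apply, LinearEquiv.coe_coe, decomposeLinearEquiv_apply,
        decompose_of_mem ℳ hx]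
      exact lmap_of _ _ _)

end MapDecomposition

end HilbertFunction

section HomogeneousEvaluation

open MvPolynomial

variable {K σ : Type*} [CommRing K] {f : MvPolynomial σ K}

theorem eval_smul_of_isHomogeneous {m : ℕ} (hf : f.IsHomogeneous m) (c : K) (x : σ → K) :
    eval (c • x) f = c ^ m * eval x f := by
  simp only [eval_eq, Finset.mul_sum, Pi.smul_apply, smul_eq_mul, mul_pow, Finset.prod_mul_distrib,
    Finset.prod_pow_eq_pow_sum]
  refine Finset.sum_congr rfl fun s hs => ?_
  rw [← Finsupp.degree_apply, not_imp_comm.mp hf.coeff_eq_zero (mem_support_iff.mp hs)]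
  ring

theorem eval_homogeneousComponent_eq_zero [IsDomain K] [Infinite K] {x : σ → K}
    (h : ∀ c : K, eval (c • x) f = 0) (i : ℕ) : eval x (homogeneousComponent i f) = 0 := by
  let g : Polynomial K := ∑ j ∈ Finset.range (f.totalDegree + 1),
    Polynomial.C (eval x (homogeneousComponent j f)) * Polynomial.X ^ j
  have hg : g = 0 := Polynomial.funext fun c => by
    rw [Polynomial.eval_zero, ← h c]
    conv_rhs => rw [← sum_homogeneousComponent f, map_sum]
    simp only [g, Polynomial.eval_finsetSum, Polynomial.eval_mul, Polynomial.eval_C,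
      Polynomial.eval_pow, Polynomial.eval_X,
      eval_smul_of_isHomogeneous (homogeneousComponent_isHomogeneous _ f), mul_comm]
  by_cases hi : i < f.totalDegree + 1
  · simpa [g, Polynomial.finsetSum_coeff, Polynomial.coeff_X_pow, Nat.lt_succ_iff.mp hi] using
      congrArg (Polynomial.coeff · i) hg
  · rw [homogeneousComponent_eq_zero _ _ (by omega), map_zero]

end HomogeneousEvaluation

section HomogeneousIdeal

open MvPolynomial

variable {d : ℕ} {X Y Z : Set (PP d)}

theorem mem_homIdeal {f : MvPolynomial (Fin (d + 1)) ℂ} :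
    f ∈ homIdeal X ↔ ∀ p ∈ X, ∀ c : ℂ, eval (c • Projectivization.rep p) f = 0 := by
  have hline (p : PP d) (x) : x ∈ Projectivization.submodule p ↔ ∃ c : ℂ, c • p.rep = x := by
    rw [Projectivization.submodule_eq (K := ℂ) (V := Fin (d + 1) → ℂ) p,
      Submodule.mem_span_singleton]
  rw [homIdeal, mem_vanishingIdeal_iff]
  simp only [Set.mem_ofPred_eq, hline, aeval_eq_eval]
  grind

theorem homIdeal_anti (h : X ⊆ Y) : homIdeal Y ≤ homIdeal X :=
  fun _ hf => mem_homIdeal.mpr fun p hp => mem_homIdeal.mp hf p (h hp)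

theorem mem_homIdeal_of_isHomogeneous {f : MvPolynomial (Fin (d + 1)) ℂ} {m : ℕ}
    (hf : f.IsHomogeneous m) :
    f ∈ homIdeal X ↔ ∀ p ∈ X, eval (Projectivization.rep p) f = 0 := by
  rw [mem_homIdeal]
  refine forall₂_congr fun p _ => ⟨fun h => by simpa using h 1, fun h c => ?_⟩
  rw [eval_smul_of_isHomogeneous hf, h, mul_zero]

attribute [local instance] MvPolynomial.gradedAlgebra

theorem isHomogeneous_homIdeal (X : Set (PP d)) :
    (homIdeal X).IsHomogeneous (homogeneousSubmodule (Fin (d + 1)) ℂ) := by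
  intro i f hf
  rw [show (DirectSum.decompose (homogeneousSubmodule (Fin (d + 1)) ℂ) f i :
    MvPolynomial (Fin (d + 1)) ℂ) = _ from decomposition.decompose'_apply f i,
    mem_homIdeal_of_isHomogeneous (homogeneousComponent_isHomogeneous i f)]
  exact fun p hp => eval_homogeneousComponent_eq_zero (mem_homIdeal.mp hf p hp) i

theorem isClosed_setOf_eval_rep_eq_zero {f : MvPolynomial (Fin (d + 1)) ℂ} {m : ℕ}
    (hf : f.IsHomogeneous m) : IsClosed {p : PP d | eval (Projectivization.rep p) f = 0} :=
  (isClosed_iff _).mpr ⟨{f}, by rintro _ rfl; exact ⟨m, hf⟩, by simp [projZeros]⟩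

theorem isPrime_homIdeal (hX : IsIrreducible X) : (homIdeal X).IsPrime := by
  refine (isHomogeneous_homIdeal X).isPrime_of_homogeneous_mem_or_mem ?_ ?_
  · obtain ⟨p, hp⟩ := hX.nonempty
    rw [Ideal.ne_top_iff_one, mem_homIdeal]
    exact fun h => by simpa using h p hp 1
  · rintro f g ⟨a, ha⟩ ⟨b, hb⟩ hfg
    rw [mem_homogeneousSubmodule] at ha hb
    rw [mem_homIdeal_of_isHomogeneous (ha.mul hb)] at hfg
    rw [mem_homIdeal_of_isHomogeneous ha, mem_homIdeal_of_isHomogeneous hb]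
    refine isPreirreducible_iff_isClosed_union_isClosed.mp hX.isPreirreducible _ _
      (isClosed_setOf_eval_rep_eq_zero ha) (isClosed_setOf_eval_rep_eq_zero hb) fun p hp => ?_
    exact mul_eq_zero.mp ((map_mul (eval _) f g).symm.trans (hfg p hp))

theorem homIdeal_le_ker_constantCoeff (hX : X.Nonempty) :
    homIdeal X ≤ RingHom.ker (constantCoeff (R := ℂ) (σ := Fin (d + 1))) := by
  obtain ⟨p, hp⟩ := hX
  exact fun f hf => by simpa using mem_homIdeal.mp hf p hp 0

theorem not_ker_constantCoeff_le_homIdeal (hX : X.Nonempty) :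
    ¬RingHom.ker (constantCoeff (R := ℂ) (σ := Fin (d + 1))) ≤ homIdeal X := by
  obtain ⟨p, hp⟩ := hX
  refine fun h => Projectivization.rep_nonzero p (funext fun j => ?_)
  simpa using mem_homIdeal.mp (h (show constantCoeff (MvPolynomial.X j) = 0 by simp)) p hp 1

theorem subset_closure_of_homIdeal_le (h : homIdeal X ≤ homIdeal Y) : Y ⊆ closure X := by
  intro p hp
  obtain ⟨T, hT, hX⟩ := (isClosed_iff (closure X)).mp isClosed_closure
  rw [hX]
  intro f hf
  obtain ⟨m, hm⟩ := hT f hf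
  have hfX : f ∈ homIdeal X := (mem_homIdeal_of_isHomogeneous hm).mpr fun q hq =>
    (hX ▸ subset_closure hq : q ∈ projZeros T) f hf
  exact (mem_homIdeal_of_isHomogeneous hm).mp (h hfX) p hp

theorem subset_of_homIdeal_image_val_le {s t : Set Z} (hs : IsClosed s)
    (h : homIdeal (Subtype.val '' s) ≤ homIdeal (Subtype.val '' t)) : t ⊆ s := fun _ hx =>
  hs.closure_subset <| closure_subtype.mpr <|
    subset_closure_of_homIdeal_le h (Set.mem_image_of_mem _ hx)

instance noetherianSpace_projectiveSpace : TopologicalSpace.NoetherianSpace (PP d) := by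
  have hanti : StrictAnti fun C : TopologicalSpace.Closeds (PP d) => homIdeal (C : Set (PP d)) :=
    fun C C' h => lt_of_le_not_ge (homIdeal_anti h.le) fun hle =>
      h.not_ge (subset_closure_of_homIdeal_le hle |>.trans C.isClosed.closure_subset)
  exact ((TopologicalSpace.noetherianSpace_TFAE (PP d)).out 0 1).mpr hanti.wellFoundedLT

end HomogeneousIdeal

section Components

variable {d : ℕ} {X Y Z : Set (PP d)}

theorem finite_components (Y : Set (PP d)) : (components Y).Finite :=
  (TopologicalSpace.NoetherianSpace.finite_irreducibleComponents).image _

theorem subset_of_mem_components (hZ : Z ∈ components Y) : Z ⊆ Y := by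
  obtain ⟨s, -, rfl⟩ := hZ
  exact Subtype.coe_image_subset Y s

theorem isIrreducible_of_mem_components (hZ : Z ∈ components Y) : IsIrreducible Z := by
  obtain ⟨s, hs, rfl⟩ := hZ
  exact hs.1.image _ continuous_subtype_val.continuousOn

theorem eq_of_homIdeal_le_of_mem_components (hX : X ∈ components Y) (hZ : Z ∈ components Y)
    (h : homIdeal X ≤ homIdeal Z) : X = Z := by
  obtain ⟨s, hs, rfl⟩ := hX
  obtain ⟨t, ht, rfl⟩ := hZ
  have hts := subset_of_homIdeal_image_val_le (isClosed_of_mem_irreducibleComponents s hs) h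
  exact congrArg _ ((ht.2 hs.1 hts).antisymm hts)

theorem dim_add_one_le_ringKrullDim_coordRing (Z : Set (PP d)) :
    dim Z + 1 ≤ ringKrullDim (CoordRing Z) := by
  rw [dim, topologicalKrullDim, ringKrullDim_quotient]
  cases isEmpty_or_nonempty (TopologicalSpace.IrreducibleCloseds Z) with
  | inl => rw [Order.krullDim_eq_bot, WithBot.bot_add]; exact bot_le
  | inr hne =>
    have hirr (T : TopologicalSpace.IrreducibleCloseds Z) :
        IsIrreducible (Subtype.val '' (T : Set Z)) :=
      T.isIrreducible.image _ continuous_subtype_val.continuousOn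
    have hle (T : TopologicalSpace.IrreducibleCloseds Z) :
        homIdeal Z ≤ homIdeal (Subtype.val '' (T : Set Z)) :=
      homIdeal_anti (Subtype.coe_image_subset Z T)
    let cone : WithBot (TopologicalSpace.IrreducibleCloseds Z) →
        (PrimeSpectrum.zeroLocus (homIdeal Z : Set (MvPolynomial (Fin (d + 1)) ℂ)))ᵒᵈ :=
      WithBot.recBotCoe
        (OrderDual.toDual ⟨⟨RingHom.ker MvPolynomial.constantCoeff, RingHom.ker_isPrime _⟩,
          (hle hne.some).trans (homIdeal_le_ker_constantCoeff (hirr _).nonempty)⟩)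
        fun T => OrderDual.toDual ⟨⟨_, isPrime_homIdeal (hirr T)⟩, hle T⟩
    have hcone : StrictMono cone := by
      refine WithBot.strictMono_iff.mpr ⟨fun T T' h => ?_, fun T => ?_⟩
      · exact lt_of_le_not_ge (homIdeal_anti (Set.image_mono h.le)) fun hle =>
          h.not_ge (subset_of_homIdeal_image_val_le T.isClosed hle)
      · exact lt_of_le_not_ge (homIdeal_le_ker_constantCoeff (hirr T).nonempty)
          (not_ker_constantCoeff_le_homIdeal (hirr T).nonempty)
    rw [← Order.krullDim_withBot]
    exact (Order.krullDim_le_of_strictMono cone hcone).trans_eq Order.krullDim_orderDual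

end Components

section Support

open MvPolynomial

variable {d k n : ℕ}

theorem annihilator_le_homIdeal_locus (γ : Tensor d k n) :
    Module.annihilator (MvPolynomial (Fin (d + 1)) ℂ) (TransposeCokernel (wedgeFamily γ)) ≤
      homIdeal (locus γ) := by
  intro f hf
  rw [mem_homIdeal]
  rintro p ⟨v, hv, hpv⟩ c
  refine (smul_eq_zero_iff_left hv).mp <|
    TransposeCokernel.eval_smul_eq_zero_of_mem_annihilator _ hf ?_
  rw [map_smul, LinearMap.smul_apply, wedgeFamily_apply, hpv, smul_zero]

theorem genericKernelDim_le (γ : Tensor d k n) {Z : Set (PP d)} (hZ : IsIrreducible Z) :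
    genericKernelDim γ Z ≤ Module.finrank (FractionRing (CoordRing Z))
      (TransposeCokernel (wedgeFamily γ) →ₗ[MvPolynomial (Fin (d + 1)) ℂ]
        FractionRing (CoordRing Z)) := by
  have := isPrime_homIdeal hZ
  rw [genericKernelDim, coordWedge_eq_coordFamily]
  exact finrank_kernel_coordFamily_le (CoordRing Z) (wedgeFamily γ) (FractionRing (CoordRing Z))

end Support

section LinearProjection

open MvPolynomial

/-- The homogeneous coordinate ring of `ℙ^m`. An algebra structure of `PolyRing d` over
`PolyRing k` which sends the variables to linear forms encodes a linear projection from `ℙ^d`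
to `ℙ^k`. -/
abbrev PolyRing (m : ℕ) : Type := MvPolynomial (Fin (m + 1)) ℂ

variable {d k n : ℕ}

theorem exists_algebra_span_gen_eq_top (hk : k ≤ d) {γ : Tensor d k n} (hγ : IsNondegenerate γ) :
    ∃ (_ : Algebra (PolyRing k) (PolyRing d)) (_ : IsScalarTower ℂ (PolyRing k) (PolyRing d)),
      (∀ l, (algebraMap (PolyRing k) (PolyRing d) (X l)).IsHomogeneous 1) ∧
      Submodule.span (PolyRing k) (Set.range (TransposeCokernel.gen (wedgeFamily γ))) = ⊤ := by
  obtain ⟨v, hv, A, hA, hγv⟩ := hγ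
  obtain ⟨Θ, hΘ⟩ := exists_contractions γ hA hγv
  obtain ⟨b, hb⟩ := exists_basis_inl_eq (l := k + 1) hv (by rw [Module.finrank_fin_fun]; omega)
  let projection : PolyRing k →ₐ[ℂ] PolyRing d := aeval fun l => linForm (b.coord (.inr l))
  have hX (l) : projection (X l) = linForm (b.coord (.inr l)) := aeval_X _ l
  let _ := projection.toAlgebra
  have := IsScalarTower.of_algebraMap_eq' projection.comp_algebraMap.symm
  refine ⟨_, this, fun l => ?_, TransposeCokernel.span_gen_eq_top _ b Θ (by simpa only [hb])
    fun l => ⟨X l, hX l⟩⟩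
  exact (hX l).symm ▸ isHomogeneous_linForm _

variable [Algebra (PolyRing k) (PolyRing d)]

theorem finite_coordRing {γ : Tensor d k n}
    (hγ : Submodule.span (PolyRing k) (Set.range (TransposeCokernel.gen (wedgeFamily γ))) = ⊤)
    {Z : Set (PP d)} (hZ : Z ⊆ locus γ) : Module.Finite (PolyRing k) (CoordRing Z) :=
  have : Module.Finite (PolyRing k) (TransposeCokernel (wedgeFamily γ)) :=
    ⟨hγ ▸ Submodule.fg_span (Set.finite_range _)⟩
  finite_quotient_of_annihilator_le ((annihilator_le_homIdeal_locus γ).trans (homIdeal_anti hZ))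

theorem faithfulSMul_coordRing {Z : Set (PP d)} (hZ : dim Z = k)
    [Module.Finite (PolyRing k) (CoordRing Z)] : FaithfulSMul (PolyRing k) (CoordRing Z) := by
  refine (faithfulSMul_iff_algebraMap_injective _ _).mpr <|
    injective_algebraMap_of_ringKrullDim_le (A := PolyRing k) (B := CoordRing Z)
      (r := k + 1) ?_ ?_
  · simp [MvPolynomial.ringKrullDim_of_isNoetherianRing]
  · simpa [hZ] using dim_add_one_le_ringKrullDim_coordRing Z

variable [IsScalarTower ℂ (PolyRing k) (PolyRing d)]

theorem isHomogeneous_algebraMap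
    (hX : ∀ l, (algebraMap (PolyRing k) (PolyRing d) (X l)).IsHomogeneous 1)
    {s : PolyRing k} {m : ℕ} (hs : s.IsHomogeneous m) :
    (algebraMap (PolyRing k) (PolyRing d) s).IsHomogeneous m := by
  rw [← IsScalarTower.coe_toAlgHom' ℂ, aeval_unique (IsScalarTower.toAlgHom ℂ _ _)]
  simpa only [one_mul] using hs.aeval (IsScalarTower.toAlgHom ℂ (PolyRing k) (PolyRing d) ∘ X) hX

attribute [local instance] MvPolynomial.gradedAlgebra

theorem varDegree_eq_finrank
    (hX : ∀ l, (algebraMap (PolyRing k) (PolyRing d) (X l)).IsHomogeneous 1)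
    {Z : Set (PP d)} [Module.Finite (PolyRing k) (CoordRing Z)]
    [Module.IsTorsionFree (PolyRing k) (CoordRing Z)] :
    varDegree k Z = Module.finrank (PolyRing k) (CoordRing Z) := by
  let gr (m : ℕ) := (homogeneousSubmodule (Fin (d + 1)) ℂ m).map
    (Ideal.Quotient.mkₐ ℂ (homIdeal Z)).toLinearMap
  have : SetLike.GradedSMul (homogeneousSubmodule (Fin (k + 1)) ℂ) gr := by
    constructor
    rintro i j s _ hs ⟨f, hf, rfl⟩
    exact ⟨s • f, Algebra.smul_def s f ▸ (isHomogeneous_algebraMap hX hs).mul hf, rfl⟩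
  have : DirectSum.Decomposition gr := mapDecomposition _ (Ideal.Quotient.mkₐ_surjective ℂ _)
    fun f hf i => Ideal.Quotient.eq_zero_iff_mem.mpr <|
      isHomogeneous_homIdeal Z i (Ideal.Quotient.eq_zero_iff_mem.mp hf)
  exact (tendsto_factorial_mul_finrank_div_pow gr).limUnder_eq

end LinearProjection

section DegreeBound

open MvPolynomial

variable {d k n : ℕ}

/-- The irreducible components of `D(γ)` that contribute to `deg γ`. -/
def degreeComponents (γ : Tensor d k n) : Set (Set (PP d)) :=
  {Z ∈ components (locus γ) | dim Z = k}

instance finite_degreeComponents (γ : Tensor d k n) : Finite (degreeComponents γ) :=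
  (finite_components (locus γ)).subset (Set.sep_subset _ _)

instance isPrime_homIdeal_degreeComponents (γ : Tensor d k n) (Z : degreeComponents γ) :
    (homIdeal (Z : Set (PP d))).IsPrime :=
  isPrime_homIdeal (isIrreducible_of_mem_components Z.2.1)

theorem eq_of_homIdeal_le_of_degreeComponents {γ : Tensor d k n} (Y Z : degreeComponents γ)
    (h : homIdeal (Y : Set (PP d)) ≤ homIdeal (Z : Set (PP d))) : Y = Z :=
  Subtype.ext (eq_of_homIdeal_le_of_mem_components Y.2.1 Z.2.1 h)

variable {γ : Tensor d k n} [Algebra (PolyRing k) (PolyRing d)]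
  [IsScalarTower ℂ (PolyRing k) (PolyRing d)]
  (hX : ∀ l, (algebraMap (PolyRing k) (PolyRing d) (X l)).IsHomogeneous 1)
  (hγ : Submodule.span (PolyRing k) (Set.range (TransposeCokernel.gen (wedgeFamily γ))) = ⊤)

include hX

theorem degree_le_sum_finrank [Fintype (degreeComponents γ)]
    [∀ Z : degreeComponents γ, Module.Finite (PolyRing k) (CoordRing (Z : Set (PP d)))]
    [∀ Z : degreeComponents γ, FaithfulSMul (PolyRing k) (CoordRing (Z : Set (PP d)))] :
    degree γ ≤ (∑ Z : degreeComponents γ,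
      Module.finrank (PolyRing k) (CoordRing (Z : Set (PP d))) *
        Module.finrank (FractionRing (CoordRing (Z : Set (PP d))))
          (TransposeCokernel (wedgeFamily γ) →ₗ[PolyRing d]
            FractionRing (CoordRing (Z : Set (PP d)))) : ℕ) := by
  have hdegree : degree γ = ∑ Z : degreeComponents γ,
      (genericKernelDim γ Z : ℝ) * varDegree k (Z : Set (PP d)) := by
    rw [← finsum_eq_sum_of_fintype]
    exact (finsum_set_coe_eq_finsum_mem (degreeComponents γ)).symm
  rw [hdegree, Nat.cast_sum]
  refine Finset.sum_le_sum fun Z _ => ?_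
  have : Module.IsTorsionFree (PolyRing k) (CoordRing (Z : Set (PP d))) :=
    Module.isTorsionFree_iff_faithfulSMul.mpr inferInstance
  rw [varDegree_eq_finrank hX, Nat.cast_mul, mul_comm]
  gcongr
  exact genericKernelDim_le γ (isIrreducible_of_mem_components Z.2.1)

include hγ

theorem degree_le : degree γ ≤ n := by
  have := Fintype.ofFinite (degreeComponents γ)
  have (Z : degreeComponents γ) := finite_coordRing hγ (subset_of_mem_components Z.2.1)
  have (Z : degreeComponents γ) := faithfulSMul_coordRing (k := k) Z.2.2
  refine (degree_le_sum_finrank hX).trans (Nat.cast_le.mpr ?_)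
  exact (sum_finrank_mul_finrank_le hγ eq_of_homIdeal_le_of_degreeComponents).trans_eq
    (Fintype.card_fin n)

theorem iInf_homIdeal_le_annihilator (hdegree : n ≤ degree γ) :
    ⨅ Z : degreeComponents γ, homIdeal (Z : Set (PP d)) ≤
      Module.annihilator (PolyRing d) (TransposeCokernel (wedgeFamily γ)) := by
  have := Fintype.ofFinite (degreeComponents γ)
  have (Z : degreeComponents γ) := finite_coordRing hγ (subset_of_mem_components Z.2.1)
  have (Z : degreeComponents γ) := faithfulSMul_coordRing (k := k) Z.2.2
  refine iInf_le_annihilator hγ eq_of_homIdeal_le_of_degreeComponents (le_antisymm ?_ ?_)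
  · exact sum_finrank_mul_finrank_le hγ eq_of_homIdeal_le_of_degreeComponents
  · rw [Fintype.card_fin]
    exact_mod_cast hdegree.trans (degree_le_sum_finrank hX)

theorem hasPureDim_locus (hdegree : n ≤ degree γ) : HasPureDim (locus γ) k := by
  have := Fintype.ofFinite (degreeComponents γ)
  intro Z hZ
  have := isPrime_homIdeal (isIrreducible_of_mem_components hZ)
  have hle : ⨅ Y : degreeComponents γ, homIdeal (Y : Set (PP d)) ≤ homIdeal Z :=
    (iInf_homIdeal_le_annihilator hX hγ hdegree).trans <|
      (annihilator_le_homIdeal_locus γ).trans (homIdeal_anti (subset_of_mem_components hZ))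
  rw [← Finset.inf_univ_eq_iInf, Ideal.IsPrime.inf_le' this] at hle
  obtain ⟨Y, -, hY⟩ := hle
  exact eq_of_homIdeal_le_of_mem_components Y.2.1 hZ hY ▸ Y.2.2

end DegreeBound

end Livsic

end

theorem mainTheorem11 {d k n : ℕ} (hk : k ≤ d) (γ : Livsic.Tensor d k n)
    (hγ : Livsic.IsNondegenerate γ) :
    Livsic.degree γ ≤ (n : ℝ) ∧
      (Livsic.IsVeryReasonable γ → Livsic.HasPureDim (Livsic.locus γ) k) := by
  obtain ⟨_, _, hX, hspan⟩ := Livsic.exists_algebra_span_gen_eq_top hk hγ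
  exact ⟨Livsic.degree_le hX hspan, fun h => Livsic.hasPureDim_locus hX hspan h.ge⟩
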